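/- Let $W$ be a group with a finite generating set $S=\{s_1,\dots,s_r\}$ and a presentation $W=\langle S\mid (s_is_j)^{m_{ij}}=1 \text{ for all } i,j \text{ with } m_{ij}\neq\infty\rangle$, where $m_{ii}=1$ and $m_{ij}=m_{ji}\in\{2,3,\dots\}\cup\{\infty\}$ for $i\ne j$ (a Coxeter system). Assume that $W$ is odd-angled, i.e. every $m_{ij}$ is odd or infinite, and that its divisibility diagram $\mathrm{Cox}_{\mathrm{div}}(W)$ is connected; this is the graph with vertex set $S$ in which distinct $s_i,s_j$ are joined, by an edge labelled with the least divisor of $m_{ij}$ greater than $1$, if and only if $m_{ij}<\infty$. For a group $G$ with a given generating set, a reflection is a conjugate in $G$ of a generator, and a reflection subgroup is a proper subgroup of $G$ (i.e. of index greater than $1$) generated by a set of reflections; the empty set is allowed, so that the trivial subgroup is a reflection subgroup when $G\neq 1$. Suppose that $W$ has a reflection subgroup $V\subsetneq W$ of index $n$ with $1<n<\infty$. Let $W_1=\langle S'\rangle$ be the special subgroup of $W$ generated by a non-empty subset $S'\subseteq S$. Then $W_1$, with generating set $S'$, contains a (proper) reflection subgroup $U$ of finite index $1<[W_1:U]\le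 n$. -/

import Mathlib

namespace OddAngled

/-- A Coxeter matrix is odd-angled if all its entries are odd or infinite
(Mathlib writes `0` for an infinite entry). -/
def IsOddAngled {B : Type*} (M : CoxeterMatrix B) : Prop :=
  ∀ i j : B, M i j = 0 ∨ Odd (M i j)

/-- The graph underlying the divisibility diagram. The vertices are the generators; two distinct
vertices are joined when `m i j` is finite, and such an edge carries as its label the least
non-trivial divisor `(M i j).minFac` of `m i j`. Connectedness of the diagram does not involve the
labels. -/
def divDiagram {B : Type*} (M : CoxeterMatrix B) : SimpleGraph B where
  Adj i j := i ≠ j ∧ M i j ≠ 0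
  symm := ⟨fun i j h => ⟨h.1.symm, by rw [M.symmetric]; exact h.2⟩⟩
  loopless := ⟨fun _ h => h.1 rfl⟩

/-- The reflections of a group `G` with respect to a set `S` of generators: the conjugates in `G`
of the elements of `S`. -/
def reflections {G : Type*} [Group G] (S : Set G) : Set G :=
  {t | ∃ s ∈ S, IsConj s t}

/-- For a Coxeter system these are Mathlib's reflections. -/
theorem mem_reflections_range_simple {B W : Type*} [Group W] {M : CoxeterMatrix B}
    (cs : CoxeterSystem M W) (t : W) :
    t ∈ reflections (Set.range cs.simple) ↔ cs.IsReflection t := by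
  simp only [reflections, CoxeterSystem.IsReflection, Set.mem_ofPred_eq, Set.exists_range_iff,
    isConj_iff]
  constructor
  · rintro ⟨i, w, h⟩
    exact ⟨w, i, h.symm⟩
  · rintro ⟨w, i, h⟩
    exact ⟨i, w, h.symm⟩

/-- A reflection subgroup of `(G, S)`: a proper subgroup generated by a (possibly empty) set of
reflections. -/
def IsReflectionSubgroup {G : Type*} [Group G] (S : Set G) (V : Subgroup G) : Prop :=
  V ≠ ⊤ ∧ ∃ T : Set G, T ⊆ reflections S ∧ Subgroup.closure T = V

/-- The special subgroup generated by a set `S'` of generating reflections. -/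
abbrev specialSubgroup {W : Type*} [Group W] (S' : Set W) : Subgroup W :=
  Subgroup.closure S'

/-- The set `S'`, regarded as the generating set of the special subgroup that it generates. -/
def specialGenerators {W : Type*} [Group W] (S' : Set W) : Set (specialSubgroup S') :=
  {x | (x : W) ∈ S'}

end OddAngled

namespace OddAngled

/-! Odd labels make adjacent generators conjugate, so by connectedness all generators are conjugate.
A proper `V` misses some generator, hence a conjugate of `V`, of the same index, misses a chosen
element of `S'`; its intersection with `W_1` is proper of index at most `n`. The main point is
`closure_reflections_inter_eq_subgroupOf`: the intersection is generated by reflections of `W_1`. A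
nontrivial `v` in it has an inversion `t` in the conjugate of `V`, because that group is generated
by canonical reflections. Strong exchange in `W_1` shows that `t` is a reflection of `W_1` and that
`t * v` has a shorter word. -/

theorem end_mul_apply {α : Type*} (f g : Function.End α) (a : α) : (f * g) a = f (g a) := rfl

theorem end_one_apply {α : Type*} (a : α) : (1 : Function.End α) a = a := rfl

/-! ### Inversion cocycles and strong exchange -/

section Cocycle

variable {W : Type*} [Group W]

/-- A function `N : W → W → ZMod 2` satisfying the cocycle identity of the (mod 2) indicator of the
left inversion set. -/
def IsInversionCocycle (N : W → W → ZMod 2) : Prop :=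
  ∀ x y t, N (x * y) t = N x t + N y (x⁻¹ * t * x)

/-- `c` is an involution whose only inversion inside the subgroup `V` is `c` itself. -/
def IsCanonical (N : W → W → ZMod 2) (V : Subgroup W) (c : W) : Prop :=
  c ∈ V ∧ c * c = 1 ∧ ∀ t ∈ V, (N c t ≠ 0 ↔ t = c)

theorem IsInversionCocycle.map_one {N : W → W → ZMod 2} (hN : IsInversionCocycle N) (t : W) :
    N 1 t = 0 := by
  simpa using hN 1 1 t

theorem exists_list_of_mem_closure_of_mul_self {C : Set W} (hC : ∀ c ∈ C, c * c = 1) {x : W}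
    (hx : x ∈ Subgroup.closure C) : ∃ L : List W, (∀ c ∈ L, c ∈ C) ∧ L.prod = x := by
  rw [← Subgroup.mem_toSubmonoid, Subgroup.closure_toSubmonoid] at hx
  obtain ⟨L, hL, rfl⟩ := Submonoid.exists_list_of_mem_closure hx
  refine ⟨L, fun c hc => ?_, rfl⟩
  rcases hL c hc with h | h
  · exact h
  · rwa [← inv_inv c, inv_eq_of_mul_eq_one_right (hC _ h)]

/-- The strong exchange property for products of canonical involutions. -/
theorem exchange {N : W → W → ZMod 2} (hN : IsInversionCocycle N) {V : Subgroup W} {C : Set W}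
    (hC : ∀ c ∈ C, IsCanonical N V c) (L : List W) (hL : ∀ c ∈ L, c ∈ C) (t : W) (ht : t ∈ V)
    (hNt : N L.prod t ≠ 0) :
    (∃ L' : List W, (∀ c ∈ L', c ∈ C) ∧ L'.length < L.length ∧ L'.prod = t * L.prod) ∧
      ∃ u ∈ Subgroup.closure C, ∃ c ∈ C, t = u * c * u⁻¹ := by
  induction L generalizing t with
  | nil => exact absurd (hN.map_one t) (by simpa using hNt)
  | cons c L ih =>
    have hcC : c ∈ C := hL c (by simp)
    have hLC : ∀ d ∈ L, d ∈ C := fun d hd => hL d (by simp [hd])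
    obtain ⟨hcV, hcc, hct⟩ := hC c hcC
    have hinv : c⁻¹ = c := inv_eq_of_mul_eq_one_right hcc
    by_cases h : t = c
    · subst h
      exact ⟨⟨L, hLC, by simp, by simp [← mul_assoc, hcc]⟩, 1, one_mem _, t, hcC, by simp⟩
    · have h0 : N c t = 0 := by
        by_contra h0
        exact h ((hct t ht).1 h0)
      rw [List.prod_cons, hN, h0, zero_add] at hNt
      obtain ⟨⟨L', hL', hlen, hprod⟩, u, hu, d, hd, hud⟩ :=
        ih hLC (c⁻¹ * t * c) (mul_mem (mul_mem (inv_mem hcV) ht) hcV) hNt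
      refine ⟨⟨c :: L', ?_, by simpa using hlen, ?_⟩, c * u,
        mul_mem (Subgroup.subset_closure hcC) hu, d, hd, ?_⟩
      · intro e he
        rcases List.mem_cons.1 he with rfl | he
        exacts [hcC, hL' e he]
      · rw [List.prod_cons, List.prod_cons, hprod]
        group
      · rw [show t = c * (c⁻¹ * t * c) * c⁻¹ by group, hud]
        group

/-- An element of a group generated by canonical involutions is trivial as soon as it has no
inversion. -/
theorem eq_one_of_forall_eq_zero {N : W → W → ZMod 2} (hN : IsInversionCocycle N) {V : Subgroup W}
    {C : Set W} (hC : ∀ c ∈ C, IsCanonical N V c) {v : W} (hv : v ∈ Subgroup.closure C)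
    (hNv : ∀ t ∈ V, N v t = 0) : v = 1 := by
  obtain ⟨L, hL, rfl⟩ := exists_list_of_mem_closure_of_mul_self (fun c hc => (hC c hc).2.1) hv
  clear hv
  induction hk : L.length using Nat.strong_induction_on generalizing L with
  | _ k ih =>
    subst hk
    cases L with
    | nil => simp
    | cons c L =>
      have hcC : c ∈ C := hL c (by simp)
      have hLC : ∀ d ∈ L, d ∈ C := fun d hd => hL d (by simp [hd])
      obtain ⟨hcV, hcc, hct⟩ := hC c hcC
      have h1 : N c c ≠ 0 := (hct c hcV).2 rfl
      -- The first letter inverts `c` but the product does not, so the tail must invert `c`;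
      -- exchange then shortens the word.
      have h2 : N L.prod c ≠ 0 := by
        intro h
        have := hNv c hcV
        rw [List.prod_cons, hN, inv_mul_cancel, one_mul, h, add_zero] at this
        exact h1 this
      obtain ⟨⟨L', hL', hlen, hprod⟩, -⟩ := exchange hN hC L hLC c hcV h2
      rw [List.prod_cons, ← hprod]
      refine ih L'.length (by simp; omega) L' hL' ?_ rfl
      rw [hprod, ← List.prod_cons]
      exact hNv

end Cocycle

/-! ### The inversion cocycle of a Coxeter system and its reflection subgroups -/

section CoxeterSystem

variable {B W : Type*} [Group W] {M : CoxeterMatrix B} (cs : CoxeterSystem M W)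

open Classical in
/-- The action of a generator on `W × ZMod 2` that encodes its inversions. -/
noncomputable def signedConj (i : B) : Function.End (W × ZMod 2) :=
  fun p => (cs.simple i * p.1 * cs.simple i, p.2 + if p.1 = cs.simple i then 1 else 0)

theorem simple_mul_simple_pow_mul (i j : B) (k : ℕ) :
    cs.simple j * (cs.simple i * cs.simple j) ^ k =
      ((cs.simple i * cs.simple j) ^ k)⁻¹ * cs.simple j := by
  induction k with
  | zero => simp
  | succ k ih =>
    rw [pow_succ, ← mul_assoc, ih, ← pow_succ, pow_succ']
    simp [mul_assoc]

open Classical in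
theorem signedConj_mul_pow_apply (i j : B) (k : ℕ) (t : W) (e : ZMod 2) :
    ((signedConj cs i * signedConj cs j) ^ k) (t, e) =
      ((cs.simple i * cs.simple j) ^ k * t * ((cs.simple i * cs.simple j) ^ k)⁻¹,
        e + ∑ l ∈ Finset.range (2 * k),
          if (cs.simple i * cs.simple j) ^ l * t = cs.simple j then 1 else 0) := by
  induction k with
  | zero => simp; rfl
  | succ k ih =>
    set r := cs.simple i * cs.simple j with hr
    have h0 : cs.simple j * r ^ k = (r ^ k)⁻¹ * cs.simple j :=
      simple_mul_simple_pow_mul cs i j k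
    have h1 : r ^ k * t * (r ^ k)⁻¹ = cs.simple j ↔ r ^ (2 * k) * t = cs.simple j := by
      rw [mul_inv_eq_iff_eq_mul, h0, eq_inv_mul_iff_mul_eq,
        two_mul, pow_add, mul_assoc]
    have h2 : cs.simple j * (r ^ k * t * (r ^ k)⁻¹) * cs.simple j = cs.simple i ↔
        r ^ (2 * k + 1) * t = cs.simple j := by
      rw [← mul_right_inj (cs.simple i), cs.simple_mul_simple_self,
        show cs.simple i * (cs.simple j * (r ^ k * t * (r ^ k)⁻¹) * cs.simple j) =
          r ^ (k + 1) * t * ((r ^ k)⁻¹ * cs.simple j) by rw [pow_succ', hr]; group,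
        ← h0, mul_eq_one_iff_eq_inv, mul_inv_rev, cs.inv_simple, eq_inv_mul_iff_mul_eq,
        ← mul_assoc, ← pow_add, show k + (k + 1) = 2 * k + 1 by omega]
    rw [pow_succ', end_mul_apply, ih, end_mul_apply]
    simp only [signedConj]
    refine Prod.ext ?_ ?_
    · simp [pow_succ', hr, mul_assoc]
    · simp only [h1, h2, mul_add, mul_one, Finset.sum_range_succ, add_assoc]

/-- Since `(s_i s_j)^m = 1`, the `2m` summands repeat with period `m` and cancel mod 2; for an
infinite label, `m = 0` and the relation is empty. -/
theorem isLiftable_signedConj : M.IsLiftable (signedConj cs) := by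
  classical
  intro i j
  funext ⟨t, e⟩
  rw [signedConj_mul_pow_apply, cs.simple_mul_simple_pow, two_mul, Finset.sum_range_add]
  simp only [pow_add, cs.simple_mul_simple_pow, one_mul, CharTwo.add_self_eq_zero]
  simp [end_one_apply]

theorem exists_isInversionCocycle :
    ∃ N : W → W → ZMod 2, IsInversionCocycle N ∧ ∀ i t, N (cs.simple i) t ≠ 0 ↔ t = cs.simple i := by
  classical
  set φ : W →* Function.End (W × ZMod 2) := cs.lift ⟨signedConj cs, isLiftable_signedConj cs⟩
  have hφs : ∀ i, φ (cs.simple i) = signedConj cs i :=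
    fun i => cs.lift_apply_simple (isLiftable_signedConj cs) i
  have hφ : ∀ w t e, φ w (t, e) = (w * t * w⁻¹, e + (φ w (t, 0)).2) := by
    intro w
    induction w using cs.simple_induction_left with
    | one => intro t e; simp [end_one_apply]
    | mul_simple_left w i ih =>
      intro t e
      rw [map_mul, end_mul_apply, end_mul_apply, ih t e, ih t 0, hφs]
      simp [signedConj, mul_assoc, add_assoc]
  -- The inverse turns the inversions recorded by the action into left inversions.
  refine ⟨fun x t => (φ x⁻¹ (t, 0)).2, ?_, ?_⟩
  · intro x y t
    simp only [mul_inv_rev, map_mul, end_mul_apply]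
    rw [hφ x⁻¹, hφ y⁻¹]
    simp
  · intro i t
    simp [hφs, signedConj]

variable {N : W → W → ZMod 2}

/-- As `s_j` is outside `V`, it is not conjugate under `V` to an element of `V`, so the two outer
letters contribute nothing to the cocycle on `V`. -/
theorem isCanonical_conj_simple (hN : IsInversionCocycle N)
    (hNs : ∀ i t, N (cs.simple i) t ≠ 0 ↔ t = cs.simple i) {V V' : Subgroup W} {j : B}
    (hV' : ∀ x, x ∈ V' ↔ cs.simple j * x * cs.simple j ∈ V) (hj : cs.simple j ∉ V) {x : W}
    (hx : IsCanonical N V' x) : IsCanonical N V (cs.simple j * x * cs.simple j) := by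
  obtain ⟨hxV, hxx, hxt⟩ := hx
  have hxV2 := (hV' x).1 hxV
  refine ⟨hxV2, ?_, fun r hr => ?_⟩
  · calc _ = cs.simple j * (x * x) * cs.simple j := by simp [mul_assoc]
      _ = 1 := by simp [hxx]
  have h1 : N (cs.simple j) r = 0 := by
    by_contra h
    exact hj ((hNs j r).1 h ▸ hr)
  have h2 : N (cs.simple j) (x⁻¹ * (cs.simple j * r * cs.simple j) * x) = 0 := by
    by_contra h
    have h := (hNs _ _).1 h
    apply hj
    have h3 : (cs.simple j * x * cs.simple j)⁻¹ * r * (cs.simple j * x * cs.simple j) =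
        cs.simple j := by
      calc _ = cs.simple j * (x⁻¹ * (cs.simple j * r * cs.simple j) * x) * cs.simple j := by
            simp [mul_assoc]
        _ = _ := by simp [h]
    rw [← h3]
    exact mul_mem (mul_mem (inv_mem hxV2) hr) hxV2
  have h4 : cs.simple j * r * cs.simple j ∈ V' := by
    rw [hV']
    simpa [mul_assoc] using hr
  rw [mul_assoc, hN, h1, zero_add, cs.inv_simple, hN, h2, add_zero, hxt _ h4]
  constructor
  · rintro rfl
    simp [mul_assoc]
  · rintro rfl
    simp [mul_assoc]

theorem mem_closure_isCanonical_of_conj_simple_mem (hN : IsInversionCocycle N)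
    (hNs : ∀ i t, N (cs.simple i) t ≠ 0 ↔ t = cs.simple i) (w : W) (i : B) (V : Subgroup W)
    (h : w * cs.simple i * w⁻¹ ∈ V) :
    w * cs.simple i * w⁻¹ ∈ Subgroup.closure {c | IsCanonical N V c} := by
  have hsimple : ∀ {V : Subgroup W} {j : B}, cs.simple j ∈ V →
      cs.simple j ∈ Subgroup.closure {c | IsCanonical N V c} := fun hj =>
    Subgroup.subset_closure ⟨hj, cs.simple_mul_simple_self _, fun t _ => hNs _ t⟩
  induction w using cs.simple_induction_left generalizing V with
  | one => simpa using hsimple (by simpa using h)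
  | mul_simple_left w j ih =>
    have key : cs.simple j * w * cs.simple i * (cs.simple j * w)⁻¹ =
      cs.simple j * (w * cs.simple i * w⁻¹) * cs.simple j := by simp [mul_assoc]
    rw [key] at h ⊢
    by_cases hj : cs.simple j ∈ V
    · refine mul_mem (mul_mem (hsimple hj) (ih V ?_)) (hsimple hj)
      rwa [Subgroup.mul_mem_cancel_right _ hj, Subgroup.mul_mem_cancel_left _ hj] at h
    -- Here `V` is replaced by its conjugate under `s_j`, which is why the induction varies `V`.
    · set f : W →* W := (MulAut.conj (cs.simple j)).toMonoidHom
      have hf : ∀ x, f x = cs.simple j * x * cs.simple j := fun x => by simp [f]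
      have hle : Subgroup.closure {c | IsCanonical N (V.comap f) c} ≤
          (Subgroup.closure {c | IsCanonical N V c}).comap f := by
        rw [Subgroup.closure_le]
        intro x hx
        rw [SetLike.mem_coe, Subgroup.mem_comap, hf]
        exact Subgroup.subset_closure
          (isCanonical_conj_simple cs hN hNs (fun x => by rw [Subgroup.mem_comap, hf]) hj hx)
      have := hle (ih (V.comap f) (by rwa [Subgroup.mem_comap, hf]))
      rwa [Subgroup.mem_comap, hf] at this

/-- A reflection subgroup is generated by its canonical reflections. -/
theorem closure_reflections_le_closure_isCanonical (hN : IsInversionCocycle N)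
    (hNs : ∀ i t, N (cs.simple i) t ≠ 0 ↔ t = cs.simple i) {T : Set W}
    (hT : ∀ t ∈ T, cs.IsReflection t) :
    Subgroup.closure T ≤ Subgroup.closure {c | IsCanonical N (Subgroup.closure T) c} := by
  rw [Subgroup.closure_le]
  intro t ht
  obtain ⟨w, i, rfl⟩ := hT t ht
  exact mem_closure_isCanonical_of_conj_simple_mem cs hN hNs w i _ (Subgroup.subset_closure ht)

/-- The intersection of a special subgroup with a subgroup generated by reflections is generated by
reflections of the special subgroup. -/
theorem closure_reflections_inter_eq_subgroupOf {T : Set W} (hT : ∀ t ∈ T, cs.IsReflection t)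
    {S' : Set W} (hS' : S' ⊆ Set.range cs.simple) :
    Subgroup.closure {t : specialSubgroup S' |
      t ∈ reflections (specialGenerators S') ∧ (t : W) ∈ Subgroup.closure T} =
      (Subgroup.closure T).subgroupOf (specialSubgroup S') := by
  obtain ⟨N, hN, hNs⟩ := exists_isInversionCocycle cs
  apply le_antisymm
  · rw [Subgroup.closure_le]
    exact fun t ht => Subgroup.mem_subgroupOf.2 ht.2
  rintro ⟨v, hvS⟩ hv
  replace hv : v ∈ Subgroup.closure T := Subgroup.mem_subgroupOf.1 hv
  have hC : ∀ c ∈ S', IsCanonical N ⊤ c := by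
    intro c hc
    obtain ⟨i, rfl⟩ := hS' hc
    exact ⟨trivial, cs.simple_mul_simple_self i, fun t _ => hNs i t⟩
  obtain ⟨L, hL, hLv⟩ := exists_list_of_mem_closure_of_mul_self (fun c hc => (hC c hc).2.1) hvS
  induction hk : L.length using Nat.strong_induction_on generalizing L v with
  | _ k ih =>
    subst hk hLv
    by_cases h : ∀ t ∈ Subgroup.closure T, N L.prod t = 0
    · have h1 : L.prod = 1 := eq_one_of_forall_eq_zero hN (fun c hc => hc)
        (closure_reflections_le_closure_isCanonical cs hN hNs hT hv) h
      simp only [h1]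
      exact one_mem _
    · push Not at h
      obtain ⟨t, htT, ht⟩ := h
      obtain ⟨⟨L', hL', hlen, hprod⟩, u, hu, c, hc, rfl⟩ := exchange hN hC L hL t trivial ht
      have htS : u * c * u⁻¹ ∈ specialSubgroup S' :=
        mul_mem (mul_mem hu (Subgroup.subset_closure hc)) (inv_mem hu)
      have := ih L'.length hlen L'.prod (by rw [hprod]; exact mul_mem htS hvS)
        (by rw [hprod]; exact mul_mem htT hv) L' hL' rfl rfl
      have hmem : (⟨u * c * u⁻¹, htS⟩ : specialSubgroup S') ∈ Subgroup.closure
          {t : specialSubgroup S' |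
            t ∈ reflections (specialGenerators S') ∧ (t : W) ∈ Subgroup.closure T} := by
        refine Subgroup.subset_closure ⟨⟨⟨c, Subgroup.subset_closure hc⟩, hc, ?_⟩, htT⟩
        exact isConj_iff.2 ⟨⟨u, hu⟩, rfl⟩
      rw [← Subgroup.mul_mem_cancel_left _ hmem]
      convert this using 2
      exact hprod.symm

theorem isConj_simple_of_odd {i j : B} (h : Odd (M i j)) :
    IsConj (cs.simple i) (cs.simple j) := by
  obtain ⟨k, hk⟩ := h
  -- With `r = s_j s_i`, conjugating `s_i` by `r^a` gives `r^(2a) s_i`, and `s_j = r s_i`; modulo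
  -- `2k + 1` the inverse of 2 is `k + 1`.
  refine isConj_iff.2 ⟨(cs.simple j * cs.simple i) ^ (k + 1), ?_⟩
  have h1 := cs.simple_mul_simple_pow' i j
  rw [hk, show 2 * k + 1 = k + (k + 1) by omega, pow_add] at h1
  rw [mul_inv_eq_iff_eq_mul, ← inv_eq_of_mul_eq_one_right h1, ← simple_mul_simple_pow_mul,
    inv_eq_of_mul_eq_one_right h1, pow_succ']
  simp [mul_assoc]

theorem isConj_simple (hodd : IsOddAngled M) (hconn : (divDiagram M).Connected) (i j : B) :
    IsConj (cs.simple i) (cs.simple j) := by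
  obtain ⟨p⟩ := hconn.preconnected i j
  induction p with
  | nil => exact IsConj.refl _
  | cons h _ ih => exact (isConj_simple_of_odd cs ((hodd _ _).resolve_left h.2)).trans ih

end CoxeterSystem

end OddAngled

theorem corollary3p2 {B W : Type*} [Finite B] [Group W] {M : CoxeterMatrix B}
    (cs : CoxeterSystem M W)
    (hodd : OddAngled.IsOddAngled M)
    (hconn : (OddAngled.divDiagram M).Connected)
    (n : ℕ) (hn : 1 < n)
    (V : Subgroup W)
    (hV : OddAngled.IsReflectionSubgroup (Set.range cs.simple) V)
    (hVn : V.index = n)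
    (S' : Set W) (hS' : S' ⊆ Set.range cs.simple) (hne : S'.Nonempty) :
    ∃ U : Subgroup (OddAngled.specialSubgroup S'),
      OddAngled.IsReflectionSubgroup (OddAngled.specialGenerators S') U ∧
        1 < U.index ∧ U.index ≤ n := by
  obtain ⟨hVtop, T, hT, rfl⟩ := hV
  obtain ⟨s, hs⟩ := hne
  obtain ⟨i, rfl⟩ := hS' hs
  obtain ⟨j, hj⟩ : ∃ j, cs.simple j ∉ Subgroup.closure T := by
    by_contra! h
    apply hVtop
    rw [eq_top_iff, ← cs.subgroup_closure_range_simple, Subgroup.closure_le]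
    rintro _ ⟨j, rfl⟩
    exact h j
  obtain ⟨g, hg⟩ := isConj_iff.1 (OddAngled.isConj_simple cs hodd hconn j i)
  set f : W →* W := (MulAut.conj g).toMonoidHom with hf
  have hclosure : Subgroup.closure (f '' T) = (Subgroup.closure T).map f :=
    (MonoidHom.map_closure f T).symm
  have hT' : ∀ t ∈ f '' T, cs.IsReflection t := by
    rintro _ ⟨t, ht, rfl⟩
    exact ((OddAngled.mem_reflections_range_simple cs t).1 (hT ht)).conj g
  have hindex : (Subgroup.closure (f '' T)).index = n := by
    rw [hclosure, ← hVn]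
    exact Subgroup.index_map_equiv _ (MulAut.conj g)
  have hi : cs.simple i ∉ Subgroup.closure (f '' T) := by
    rw [hclosure]
    rintro ⟨x, hx, hxi⟩
    have : x = cs.simple j := (MulAut.conj g).injective (hxi.trans hg.symm)
    exact hj (this ▸ hx)
  have heq := OddAngled.closure_reflections_inter_eq_subgroupOf cs hT' hS'
  set U := (Subgroup.closure (f '' T)).subgroupOf (OddAngled.specialSubgroup S') with hU
  have hUtop : U ≠ ⊤ := fun h => hi (Subgroup.mem_subgroupOf.1
    (h ▸ Subgroup.mem_top (⟨cs.simple i, Subgroup.subset_closure hs⟩ :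
      OddAngled.specialSubgroup S')))
  have hn0 : (Subgroup.closure (f '' T)).relIndex ⊤ ≠ 0 := by
    rw [Subgroup.relIndex_top_right]
    omega
  have hle : U.index ≤ n := by
    have := Subgroup.relIndex_le_of_le_right (le_top (a := OddAngled.specialSubgroup S')) hn0
    rwa [Subgroup.relIndex_top_right, hindex] at this
  have : (Subgroup.closure (f '' T)).FiniteIndex := ⟨by omega⟩
  have h0 : U.index ≠ 0 := Subgroup.FiniteIndex.index_ne_zero
  have h1 : U.index ≠ 1 := fun h => hUtop (Subgroup.index_eq_one.1 h)
  exact ⟨U, ⟨hUtop, _, fun t ht => ht.1, heq⟩, by omega, hle⟩
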